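/- Let $n\ge 0$ and let $m_1,\dots,m_n$ be natural numbers. A game of size $m_1\times\dots\times m_n$ has players $1,\dots,n$, where player $i$ has a set $S^i$ of $m_i$ pure strategies, and is given by utility functions $U^i : S\to\mathbb{R}$, where $S=S^1\times\dots\times S^n$; it is thus identified with a point of $(\mathbb{R}^{m_1\cdots m_n})^n$ with its usual topology. A correlated equilibrium of such a game is a probability distribution $\mu$ on $S$ such that, for every player $i$ and all $s^i,t^i\in S^i$, $$\sum_{s^{-i}\in\prod_{j\ne i}S^j}\mu(s^i,s^{-i})\,\bigl[U^i(s^i,s^{-i})-U^i(t^i,s^{-i})\bigr]\ \ge\ 0 .$$ Then: (a) The set of games of size $m_1\times\dots\times m_n$ with exactly one correlated equilibrium is open in $(\mathbb{R}^{m_1\cdots m_n})^n$. (b) If a game $G$ of size $m_1\times\dots\times m_n$ has a unique correlated equilibrium $\sigma$, then there is a neighbourhood of $G$ in $(\mathbb{R}^{m_1\cdots m_n})^n$ such that every game $\hat G$ in it has a unique correlated equilibrium $\hat\sigma$, and $\{s\in S:\hat\sigma(s)>0\}=\{s\in S:\sigma(s)>0\}$. -/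

import Mathlib

open Filter Topology

/-- Pure strategy profiles of a game of size `m 0 × ⋯ × m (n - 1)`. -/
abbrev Profile {n : ℕ} (m : Fin n → ℕ) : Type := (i : Fin n) → Fin (m i)

/-- An `n`-player game of size `m 0 × ⋯ × m (n - 1)`, identified with its payoffs:
`U i s` is the utility of player `i` at the profile `s`. The topology is the product
topology, i.e. the usual topology of the finite-dimensional payoff space. -/
abbrev Game {n : ℕ} (m : Fin n → ℕ) : Type := Fin n → Profile m → ℝ

/-- The linear form `h^{a,b}(μ) = ∑_{s^{-i}} μ(a, s^{-i}) [U^i(a, s^{-i}) - U^i(b, s^{-i})]`.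
The profiles `(a, s^{-i})` are exactly the profiles `s` with `s i = a`. -/
noncomputable def incentive {n : ℕ} {m : Fin n → ℕ} (U : Game m) (i : Fin n)
    (a b : Fin (m i)) (μ : Profile m → ℝ) : ℝ :=
  ∑ s : Profile m with s i = a, μ s * (U i s - U i (Function.update s i b))

/-- `μ` is a correlated equilibrium of `U`: a probability distribution on the set of pure
strategy profiles satisfying all incentive constraints. -/
def IsCorrelatedEquilibrium {n : ℕ} {m : Fin n → ℕ} (U : Game m)
    (μ : Profile m → ℝ) : Prop :=
  μ ∈ stdSimplex ℝ (Profile m) ∧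
    ∀ (i : Fin n) (a b : Fin (m i)), 0 ≤ incentive U i a b μ

/-- The set of profiles with positive probability under `μ`. -/
def profileSupport {n : ℕ} {m : Fin n → ℕ} (μ : Profile m → ℝ) : Set (Profile m) :=
  {s | 0 < μ s}

/-! ### Theorems of the alternative. -/

section LinearAlternative

/-! Keep only the constraints active at the unique equilibrium `σ` of `U`. By uniqueness they cut
out exactly the line through `σ`. By compactness of the unit sphere, for `V` near `U` nonzero
elements of the corresponding cone have nonzero mass and, up to its sign, satisfy the inactive
constraints strictly. Once the cone has elements of mass `1` and `-1`, adding the latter to any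
element of mass `1` gives mass `0`, hence `0`: the element of mass `1` is unique, and is the
equilibrium sought.

Existence for either sign is the game-theoretic point. Otherwise Stiemke's theorem yields positive
weights with which the active constraints of `V` and a nonzero multiple of the mass sum to zero
identically. Read incentive weights as transition rates: a product of stationary distributions
cancels the incentive part for all payoffs (`exists_product_cancelling`). The nonnegativity part
vanishes too if the product lives in the support of `σ`; `exists_closed_product_subset_support`
arranges this by the same argument applied to `U`. Evaluating there forces a nonzero number to be
zero. -/

theorem apply_eq_sum_mul_single {J : Type*} [Fintype J] [DecidableEq J]
    (f : StrongDual ℝ (J → ℝ)) (y : J → ℝ) : f y = ∑ j, y j * f (Pi.single j 1) := by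
  conv_lhs => rw [pi_eq_sum_univ' y]
  simp only [map_sum, map_smul, smul_eq_mul]

/-- Stiemke's theorem: a linear map whose image meets the nonnegative orthant only at the origin
is annihilated by a strictly positive functional. -/
theorem exists_pos_annihilator {J E : Type*} [Fintype J] [AddCommGroup E] [Module ℝ E]
    (L : E →ₗ[ℝ] (J → ℝ)) (h : ∀ x, (∀ j, 0 ≤ L x j) → ∀ j, L x j = 0) :
    ∃ α : J → ℝ, (∀ j, 0 < α j) ∧ ∀ x, ∑ j, α j * L x j = 0 := by
  classical
  have hdisj : Disjoint (stdSimplex ℝ J) (LinearMap.range L : Set (J → ℝ)) := by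
    rw [Set.disjoint_left]
    rintro y ⟨hy0, hy1⟩ ⟨x, rfl⟩
    have := h x hy0
    simp [this] at hy1
  obtain ⟨f, u, v, hu, huv, hv⟩ := geometric_hahn_banach_compact_closed
    (convex_stdSimplex ℝ J) (isCompact_stdSimplex ℝ J) (LinearMap.range L).convex
    (LinearMap.range L).closed_of_finiteDimensional hdisj
  have hzero : ∀ x, f (L x) = 0 := by
    intro x
    by_contra hne
    -- A functional bounded below by `v` on a subspace vanishes there: this multiple would take the
    -- value `v - 1`.
    have := hv (L (((v - 1) / f (L x)) • x)) ⟨_, rfl⟩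
    rw [map_smul, map_smul, smul_eq_mul, div_mul_cancel₀ _ hne] at this
    linarith
  have hv0 : v < 0 := by simpa using hv 0 (LinearMap.range L).zero_mem
  have hsum : ∀ y : J → ℝ, f y = ∑ j, y j * f (Pi.single j 1) :=
    apply_eq_sum_mul_single f
  refine ⟨fun j => -f (Pi.single j 1), fun j => ?_, fun x => ?_⟩
  · have := hu _ (single_mem_stdSimplex ℝ j)
    linarith
  · have := hsum (L x)
    rw [hzero] at this
    simp only [neg_mul, Finset.sum_neg_distrib, neg_eq_zero, mul_comm (f _)]
    exact this.symm

/-- Stiemke's theorem for the coordinates selected by `P`. -/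
theorem exists_pos_annihilator_on {J E : Type*} [Fintype J] [AddCommGroup E] [Module ℝ E]
    (P : J → Prop) (L : E →ₗ[ℝ] (J → ℝ))
    (h : ∀ x, (∀ j, P j → 0 ≤ L x j) → ∀ j, P j → L x j = 0) :
    ∃ α : J → ℝ, (∀ j, P j → 0 < α j) ∧ (∀ j, ¬ P j → α j = 0) ∧
      ∀ x, ∑ j, α j * L x j = 0 := by
  classical
  obtain ⟨α, hα, hs⟩ := exists_pos_annihilator
    ((LinearMap.funLeft ℝ ℝ (Subtype.val : {j // P j} → J)).comp L)
    (fun x hx j => h x (fun j hj => hx ⟨j, hj⟩) j j.2)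
  refine ⟨fun j => if hj : P j then α ⟨j, hj⟩ else 0, fun j hj => ?_, fun j hj => ?_, fun x => ?_⟩
  · simpa [hj] using hα ⟨j, hj⟩
  · simp [hj]
  · refine Eq.trans ?_ (hs x)
    rw [← Fintype.sum_subtype_add_sum_subtype P]
    rw [Finset.sum_eq_zero (s := (Finset.univ : Finset {j // ¬ P j}))
      (fun j _ => by simp [j.2]), add_zero]
    refine Finset.sum_congr rfl fun j _ => ?_
    simp [j.2, LinearMap.funLeft_apply]

/-- Stiemke's theorem with one further strict coordinate `g`. -/
theorem exists_pos_annihilator_on_add {J E : Type*} [Fintype J] [AddCommGroup E] [Module ℝ E]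
    (P : J → Prop) (L : E →ₗ[ℝ] (J → ℝ)) (g : E →ₗ[ℝ] ℝ)
    (h : ∀ x, (∀ j, P j → 0 ≤ L x j) → 0 ≤ g x → x = 0) :
    ∃ (α : J → ℝ) (c : ℝ), 0 < c ∧ (∀ j, P j → 0 < α j) ∧ (∀ j, ¬ P j → α j = 0) ∧
      ∀ x, ∑ j, α j * L x j + c * g x = 0 := by
  -- The coordinate `none` carries `g` and is always selected.
  obtain ⟨α, hpos, hzero, hs⟩ := exists_pos_annihilator_on
    (fun o : Option J => ∀ j, o = some j → P j)
    (LinearMap.pi fun o : Option J => o.elim g fun j => (LinearMap.proj j).comp L)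
    (by
      intro x hx j _
      have : x = 0 := h x (fun j hj => by simpa using hx (some j) (by simpa using hj))
        (by simpa using hx none (by simp))
      simp [this])
  refine ⟨fun j => α (some j), α none, hpos _ (by simp), fun j hj => hpos _ (by simpa using hj),
    fun j hj => hzero _ (by simpa using hj), fun x => ?_⟩
  have := hs x
  rw [Fintype.sum_option] at this
  simp at this
  linarith

end LinearAlternative

/-! ### Stationary distributions. -/

section Stationary

/-- A finite system of transition rates has a stationary distribution on each nonempty
closed set of states. -/
theorem exists_stationary {ι : Type*} [Fintype ι] (α : ι → ι → ℝ) (hα : ∀ a b, 0 ≤ α a b)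
    (R : Set ι) (hR : R.Nonempty) (hcl : ∀ a ∈ R, ∀ b, 0 < α a b → b ∈ R) :
    ∃ p ∈ stdSimplex ℝ ι, (∀ a, a ∉ R → p a = 0) ∧
      ∀ b, ∑ a, p a * α a b = p b * ∑ c, α b c := by
  classical
  let D : (ι → ℝ) →ₗ[ℝ] (ι → ℝ) :=
    { toFun := fun p b => ∑ a, p a * α a b - p b * ∑ c, α b c
      map_add' := by
        intro p q
        ext b
        simp only [Pi.add_apply, add_mul, Finset.sum_add_distrib]
        ring
      map_smul' := by
        intro r p
        ext b
        simp only [Pi.smul_apply, smul_eq_mul, RingHom.id_apply, mul_sub, Finset.mul_sum, mul_assoc] }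
  have hDapp : ∀ p b, D p b = ∑ a, p a * α a b - p b * ∑ c, α b c := fun _ _ => rfl
  let C : Set (ι → ℝ) := stdSimplex ℝ ι ∩ {p | ∀ a, a ∉ R → p a = 0}
  have hCc : IsCompact C := (isCompact_stdSimplex ℝ ι).inter_right (by
    simp only [Set.ofPred_forall]
    exact isClosed_iInter fun a => isClosed_iInter fun _ =>
      isClosed_eq (continuous_apply a) continuous_const)
  have hCv : Convex ℝ C := (convex_stdSimplex ℝ ι).inter (by
    intro p hp q hq s t _ _ _ a ha
    simp [hp a ha, hq a ha])
  by_cases h0 : (0 : ι → ℝ) ∈ D '' C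
  · obtain ⟨p, ⟨hp, hpR⟩, hDp⟩ := h0
    exact ⟨p, hp, hpR, fun b => sub_eq_zero.1 (congrFun hDp b)⟩
  · exfalso
    obtain ⟨f, u, hu0, hu⟩ := geometric_hahn_banach_point_closed (hCv.linear_image D)
      (hCc.image D.continuous_of_finiteDimensional).isClosed h0
    rw [map_zero] at hu0
    have hsum : ∀ y : ι → ℝ, f y = ∑ j, y j * f (Pi.single j 1) :=
      apply_eq_sum_mul_single f
    set g : ι → ℝ := fun j => f (Pi.single j 1) with hg
    -- From a maximiser of `g` on the closed set `R` the drift of `g` is nonpositive, whereas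
    -- separation makes it positive.
    obtain ⟨a, haR, hmax⟩ := Set.exists_max_image R g (Set.toFinite R) hR
    have hlt := hu _ ⟨Pi.single a 1, ⟨single_mem_stdSimplex ℝ a, fun b hb => by
      have : b ≠ a := fun h => hb (h ▸ haR)
      simp [this]⟩, rfl⟩
    have hval : f (D (Pi.single a 1)) = ∑ b, α a b * (g b - g a) := by
      rw [hsum]
      simp only [hDapp, sub_mul, mul_sub, Finset.sum_sub_distrib, Pi.single_apply, ite_mul,
        one_mul, zero_mul, Finset.sum_ite_eq', Finset.mem_univ, if_true, Finset.sum_mul, hg]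
    have hle : ∑ b, α a b * (g b - g a) ≤ 0 := by
      refine Finset.sum_nonpos fun b _ => ?_
      rcases (hα a b).eq_or_lt with h | h
      · simp [← h]
      · exact mul_nonpos_of_nonneg_of_nonpos h.le (sub_nonpos.2 (hmax b (hcl a haR b h)))
    linarith

/-- The support of a stationary distribution is closed under transitions. -/
theorem stationary_support_closed {ι : Type*} [Fintype ι] {α : ι → ι → ℝ}
    (hα : ∀ a b, 0 ≤ α a b) {p : ι → ℝ} (hp : ∀ a, 0 ≤ p a)
    (hst : ∀ b, ∑ a, p a * α a b = p b * ∑ c, α b c) {a b : ι} (ha : 0 < p a)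
    (hab : 0 < α a b) : 0 < p b := by
  refine (hp b).lt_of_ne fun h => ?_
  have h1 := hst b
  rw [← h, zero_mul, Finset.sum_eq_zero_iff_of_nonneg
    fun c _ => mul_nonneg (hp c) (hα c b)] at h1
  exact (mul_pos ha hab).ne' (h1 a (Finset.mem_univ a))

end Stationary

/-! ### Product distributions and deviations. -/

section Games

variable {n : ℕ} {m : Fin n → ℕ}

/-- The product of the mixed strategies `p i`. -/
def productDistribution (p : (i : Fin n) → Fin (m i) → ℝ) (s : Profile m) : ℝ :=
  ∏ i, p i (s i)

theorem productDistribution_nonneg {p : (i : Fin n) → Fin (m i) → ℝ}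
    (hp : ∀ i a, 0 ≤ p i a) (s : Profile m) : 0 ≤ productDistribution p s :=
  Finset.prod_nonneg fun i _ => hp i (s i)

theorem sum_productDistribution {p : (i : Fin n) → Fin (m i) → ℝ}
    (hp : ∀ i, ∑ a, p i a = 1) : ∑ s, productDistribution p s = 1 := by
  have := Finset.prod_univ_sum (fun i => (Finset.univ : Finset (Fin (m i)))) p
  simp only [hp, Finset.prod_const_one, Fintype.piFinset_univ] at this
  exact this.symm

theorem incentive_weighted_sum (V : Game m) (i : Fin n) (α : Fin (m i) → Fin (m i) → ℝ)
    (μ : Profile m → ℝ) :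
    ∑ a, ∑ b, α a b * incentive V i a b μ =
      ∑ s, ∑ b, α (s i) b * (μ s * (V i s - V i (Function.update s i b))) := by
  simp only [incentive, Finset.mul_sum, Finset.sum_filter]
  calc _ = ∑ a, ∑ s : Profile m, ∑ b, (if s i = a then
        α a b * (μ s * (V i s - V i (Function.update s i b))) else 0) := by
        refine Finset.sum_congr rfl fun a _ => ?_
        rw [Finset.sum_comm]
        simp only [mul_ite, mul_zero]
    _ = _ := by
        rw [Finset.sum_comm]
        refine Finset.sum_congr rfl fun s _ => ?_
        rw [Finset.sum_comm]
        refine Finset.sum_congr rfl fun b _ => ?_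
        simp

/-- Against a product of stationary distributions, the expected gain of a player from
the deviations with rates `α` vanishes, whatever the payoffs. -/
theorem stationary_incentive_sum_eq_zero (V : Game m) (p : (i : Fin n) → Fin (m i) → ℝ)
    (i : Fin n) (α : Fin (m i) → Fin (m i) → ℝ)
    (hst : ∀ b, ∑ a, p i a * α a b = p i b * ∑ c, α b c) :
    ∑ a, ∑ b, α a b * incentive V i a b (productDistribution p) = 0 := by
  classical
  rw [incentive_weighted_sum]
  set q : Profile m → ℝ := fun s => ∏ j ∈ Finset.univ.erase i, p j (s j) with hq
  have hπ : ∀ s, productDistribution p s = p i (s i) * q s := fun s =>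
    (Finset.mul_prod_erase _ _ (Finset.mem_univ i)).symm
  have hqu : ∀ s b, q (Function.update s i b) = q s := fun s b =>
    Finset.prod_congr rfl fun j hj => by
      rw [Function.update_of_ne (Finset.ne_of_mem_erase hj)]
  -- The involution exchanges the recommended strategy `s i` with the deviation `b`; `q` ignores
  -- coordinate `i`.
  have hswap : ∑ x : Profile m × Fin (m i),
        α (x.1 i) x.2 * (p i (x.1 i) * q x.1) * V i (Function.update x.1 i x.2) =
      ∑ x : Profile m × Fin (m i), α x.2 (x.1 i) * (p i x.2 * q x.1) * V i x.1 := by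
    refine Finset.sum_bij' (fun x _ => (Function.update x.1 i x.2, x.1 i))
      (fun x _ => (Function.update x.1 i x.2, x.1 i)) ?_ ?_ ?_ ?_ ?_ <;> simp [hqu]
  rw [Fintype.sum_prod_type, Fintype.sum_prod_type] at hswap
  simp only [hπ, mul_sub, Finset.sum_sub_distrib, ← mul_assoc] at hswap ⊢
  rw [hswap, sub_eq_zero]
  refine Finset.sum_congr rfl fun s _ => ?_
  have h := congrArg (fun x => x * (q s * V i s)) (hst (s i))
  simp only [Finset.sum_mul, Finset.mul_sum] at h
  calc _ = ∑ b, p i (s i) * α (s i) b * (q s * V i s) :=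
        Finset.sum_congr rfl fun b _ => by ring
    _ = ∑ a, p i a * α a (s i) * (q s * V i s) := h.symm
    _ = _ := Finset.sum_congr rfl fun b _ => by ring

/-! ### Correlated equilibria as a linear system. -/

/-- Indices of the linear inequalities defining correlated equilibria: incentive constraints
and nonnegativity constraints. -/
abbrev ConstraintIndex (m : Fin n → ℕ) : Type :=
  (Σ i : Fin n, Fin (m i) × Fin (m i)) ⊕ Profile m

/-- The linear map whose nonnegativity, with total mass one, defines correlated equilibria. -/
noncomputable def constraintMap (V : Game m) :
    (Profile m → ℝ) →ₗ[ℝ] (ConstraintIndex m → ℝ) where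
  toFun ν := Sum.elim (fun x => incentive V x.1 x.2.1 x.2.2 ν) ν
  map_add' μ ν := by
    ext (x | s)
    · simp [incentive, add_mul, Finset.sum_add_distrib]
    · simp
  map_smul' r ν := by
    ext (x | s)
    · simp [incentive, mul_assoc, Finset.mul_sum]
    · simp

/-- Total mass as a linear functional. -/
noncomputable def totalMass (m : Fin n → ℕ) : (Profile m → ℝ) →ₗ[ℝ] ℝ where
  toFun ν := ∑ s, ν s
  map_add' μ ν := by simp [Finset.sum_add_distrib]
  map_smul' r ν := by simp [Finset.mul_sum]

theorem isCorrelatedEquilibrium_iff {V : Game m} {μ : Profile m → ℝ} :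
    IsCorrelatedEquilibrium V μ ↔ totalMass m μ = 1 ∧ ∀ j, 0 ≤ constraintMap V μ j := by
  constructor
  · rintro ⟨⟨h0, h1⟩, h⟩
    refine ⟨h1, ?_⟩
    rintro (⟨i, a, b⟩ | s)
    · exact h i a b
    · exact h0 s
  · rintro ⟨h1, h⟩
    exact ⟨⟨fun s => h (Sum.inr s), h1⟩, fun i a b => h (Sum.inl ⟨i, a, b⟩)⟩

theorem continuous_constraintMap (j : ConstraintIndex m) :
    Continuous fun x : Game m × (Profile m → ℝ) => constraintMap x.1 x.2 j := by
  rcases j with ⟨i, a, b⟩ | s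
  · change Continuous fun x : Game m × (Profile m → ℝ) => incentive x.1 i a b x.2
    unfold incentive
    fun_prop
  · change Continuous fun x : Game m × (Profile m → ℝ) => x.2 s
    fun_prop

theorem continuous_totalMass : Continuous (totalMass m) :=
  (totalMass m).continuous_of_finiteDimensional

/-! ### The active cone and the support of the equilibrium. -/

/-- The cone cut out by those constraints of `V` that are active at `σ` in `U`. -/
def activeCone (U : Game m) (σ : Profile m → ℝ) (V : Game m) : Set (Profile m → ℝ) :=
  {ν | ∀ j, constraintMap U σ j = 0 → 0 ≤ constraintMap V ν j}

theorem smul_mem_activeCone {U V : Game m} {σ ν : Profile m → ℝ} (hν : ν ∈ activeCone U σ V)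
    {r : ℝ} (hr : 0 ≤ r) : r • ν ∈ activeCone U σ V := fun j hj => by
  simpa using mul_nonneg hr (hν j hj)

theorem add_mem_activeCone {U V : Game m} {σ μ ν : Profile m → ℝ} (hμ : μ ∈ activeCone U σ V)
    (hν : ν ∈ activeCone U σ V) : μ + ν ∈ activeCone U σ V := fun j hj => by
  simpa using add_nonneg (hμ j hj) (hν j hj)

/-- At a unique correlated equilibrium the active cone is the line through it. -/
theorem eq_smul_of_mem_activeCone {U : Game m} {σ : Profile m → ℝ}
    (hσ : IsCorrelatedEquilibrium U σ)
    (huniq : ∀ μ, IsCorrelatedEquilibrium U μ → μ = σ) {ν : Profile m → ℝ}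
    (hν : ν ∈ activeCone U σ U) : ν = totalMass m ν • σ := by
  obtain ⟨hσ1, hσ0⟩ := isCorrelatedEquilibrium_iff.1 hσ
  set w := ν - totalMass m ν • σ with hw
  have hw0 : totalMass m w = 0 := by simp [hw, hσ1]
  have hwact : ∀ j, constraintMap U σ j = 0 → 0 ≤ constraintMap U w j := fun j hj => by
    simpa [hw, hj] using hν j hj
  -- A small step from `σ` along `w` stays feasible: active constraints do not decrease, inactive
  -- ones have slack.
  have hev : ∀ᶠ t : ℝ in 𝓝[>] 0, ∀ j, 0 ≤ constraintMap U (σ + t • w) j := by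
    refine eventually_all.2 fun j => ?_
    rcases (hσ0 j).eq_or_lt with h | h
    · filter_upwards [self_mem_nhdsWithin] with t ht
      simpa [← h] using mul_nonneg (le_of_lt ht) (hwact j h.symm)
    · have hc : Continuous fun t : ℝ => constraintMap U (σ + t • w) j :=
        (continuous_constraintMap j).comp (continuous_const.prodMk (by fun_prop))
      have : ∀ᶠ t : ℝ in 𝓝 0, 0 < constraintMap U (σ + t • w) j :=
        hc.continuousAt.eventually (lt_mem_nhds (by simpa using h))
      exact (this.filter_mono nhdsWithin_le_nhds).mono fun t ht => ht.le
  obtain ⟨t, ht, ht0⟩ := (hev.and self_mem_nhdsWithin).exists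
  have := huniq _ (isCorrelatedEquilibrium_iff.2 ⟨by simp [hσ1, hw0], ht⟩)
  have hw' : w = 0 := by
    have h2 : t • w = 0 := by simpa using this
    exact (smul_eq_zero.1 h2).resolve_left (ne_of_gt ht0)
  exact sub_eq_zero.1 hw'

theorem weighted_constraint_sum (V : Game m) (α : ConstraintIndex m → ℝ) (ν : Profile m → ℝ) :
    ∑ j, α j * constraintMap V ν j =
      ∑ i, ∑ a, ∑ b, α (Sum.inl ⟨i, a, b⟩) * incentive V i a b ν +
        ∑ s, α (Sum.inr s) * ν s := by
  rw [Fintype.sum_sum_type, Fintype.sum_sigma]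
  simp only [Fintype.sum_prod_type]
  rfl

/-- For nonnegative weights on the constraints and a product of sets closed under the positive
weights, there is a product distribution living there on which the weighted incentive
constraints cancel for all payoffs. -/
theorem exists_product_cancelling (α : ConstraintIndex m → ℝ) (hα : ∀ j, 0 ≤ α j)
    (R : (i : Fin n) → Set (Fin (m i))) (hR : ∀ i, (R i).Nonempty)
    (hcl : ∀ i, ∀ a ∈ R i, ∀ b, 0 < α (Sum.inl ⟨i, a, b⟩) → b ∈ R i) :
    ∃ p : (i : Fin n) → Fin (m i) → ℝ, (∀ i, p i ∈ stdSimplex ℝ (Fin (m i))) ∧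
      (∀ i a, a ∉ R i → p i a = 0) ∧
      (∀ i a b, 0 < p i a → 0 < α (Sum.inl ⟨i, a, b⟩) → 0 < p i b) ∧
      ∀ V : Game m, ∑ j, α j * constraintMap V (productDistribution p) j =
        ∑ s, α (Sum.inr s) * productDistribution p s := by
  choose p hp hpR hst using fun i => exists_stationary
    (fun a b => α (Sum.inl ⟨i, a, b⟩)) (fun a b => hα _) (R i) (hR i) (hcl i)
  refine ⟨p, hp, hpR, fun i a b ha hab =>
    stationary_support_closed (α := fun a b => α (Sum.inl ⟨i, a, b⟩)) (fun a b => hα _)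
      (hp i).1 (hst i) ha hab, fun V => ?_⟩
  rw [weighted_constraint_sum, Finset.sum_eq_zero fun i _ =>
    stationary_incentive_sum_eq_zero V p i _ (hst i), zero_add]

/-- The support of a unique correlated equilibrium contains a nonempty product set that is closed
under the deviations with active incentive constraint. -/
theorem exists_closed_product_subset_support {U : Game m} {σ : Profile m → ℝ}
    (hσ : IsCorrelatedEquilibrium U σ)
    (huniq : ∀ μ, IsCorrelatedEquilibrium U μ → μ = σ) :
    ∃ R : (i : Fin n) → Set (Fin (m i)), (∀ i, (R i).Nonempty) ∧
      (∀ i, ∀ a ∈ R i, ∀ b, incentive U i a b σ = 0 → b ∈ R i) ∧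
      ∀ s : Profile m, (∀ i, s i ∈ R i) → σ s ≠ 0 := by
  obtain ⟨α, hpos, hzero, hs⟩ := exists_pos_annihilator_on
    (fun j => constraintMap U σ j = 0) (constraintMap U) (by
      intro x hx j hj
      rw [eq_smul_of_mem_activeCone hσ huniq hx]
      simp [hj])
  have hα : ∀ j, 0 ≤ α j := fun j => by
    by_cases h : constraintMap U σ j = 0
    · exact (hpos j h).le
    · exact (hzero j h).ge
  have hne : Nonempty (Profile m) := by
    by_contra h
    rw [not_nonempty_iff] at h
    simpa using hσ.1.2
  obtain ⟨p, hp, -, hcl, hV⟩ := exists_product_cancelling α hα (fun _ => Set.univ)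
    (fun i => ⟨hne.some i, trivial⟩) (fun _ _ _ _ _ => trivial)
  refine ⟨fun i => {a | 0 < p i a}, fun i => ?_, fun i a ha b hab => hcl i a b ha (hpos _ hab),
    fun s hsR hσs => ?_⟩
  · by_contra h
    have h0 : ∀ a, p i a = 0 := fun a => le_antisymm
      (not_lt.1 fun ha => h ⟨a, ha⟩) ((hp i).1 a)
    simpa [h0] using (hp i).2
  · have h0 := (hV U).symm.trans (hs _)
    rw [Finset.sum_eq_zero_iff_of_nonneg fun s _ =>
      mul_nonneg (hα _) (productDistribution_nonneg (fun i => (hp i).1) s)] at h0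
    exact (mul_pos (hpos (Sum.inr s) hσs) (Finset.prod_pos fun i _ => hsR i)).ne'
      (h0 s (Finset.mem_univ s))

/-! ### Perturbing the game. -/

/-- For games near `U`, the nonzero elements of the active cone have nonzero mass and, up to the
sign of that mass, satisfy strictly the constraints that are inactive at `σ`. -/
theorem eventually_activeCone_strict {U : Game m} {σ : Profile m → ℝ}
    (hσ : IsCorrelatedEquilibrium U σ)
    (huniq : ∀ μ, IsCorrelatedEquilibrium U μ → μ = σ) :
    ∀ᶠ V in 𝓝 U, ∀ ν ∈ activeCone U σ V, ν ≠ 0 → totalMass m ν ≠ 0 ∧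
      ∀ j, constraintMap U σ j ≠ 0 → 0 < constraintMap V ν j * totalMass m ν := by
  obtain ⟨hσ1, hσ0⟩ := isCorrelatedEquilibrium_iff.1 hσ
  have hM : Continuous fun x : Game m × (Profile m → ℝ) => totalMass m x.2 :=
    continuous_totalMass.comp continuous_snd
  have key : ∀ᶠ V in 𝓝 U, ∀ ν ∈ Metric.sphere (0 : Profile m → ℝ) 1,
      ν ∈ activeCone U σ V → totalMass m ν ≠ 0 ∧
      ∀ j, constraintMap U σ j ≠ 0 → 0 < constraintMap V ν j * totalMass m ν := by
    refine (isCompact_sphere _ _).eventually_forall_of_forall_eventually fun ν hν => ?_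
    by_cases hmem : ν ∈ activeCone U σ U
    · have hν0 : ν ≠ 0 := by
        rintro rfl
        simp at hν
      have heq := eq_smul_of_mem_activeCone hσ huniq hmem
      have ht : totalMass m ν ≠ 0 := fun h => hν0 (by rw [heq, h, zero_smul])
      have h1 : ∀ᶠ x : Game m × (Profile m → ℝ) in 𝓝 (U, ν), totalMass m x.2 ≠ 0 :=
        hM.continuousAt.eventually_ne ht
      have h2 : ∀ᶠ x : Game m × (Profile m → ℝ) in 𝓝 (U, ν), ∀ j, constraintMap U σ j ≠ 0 →
          0 < constraintMap x.1 x.2 j * totalMass m x.2 := by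
        refine eventually_all.2 fun j => ?_
        by_cases hj : constraintMap U σ j = 0
        · exact Eventually.of_forall fun x h => absurd hj h
        · have hp : 0 < constraintMap U ν j * totalMass m ν := by
            have : constraintMap U ν j = totalMass m ν * constraintMap U σ j := by
              conv_lhs => rw [heq]
              simp
            rw [this, mul_right_comm]
            exact mul_pos (mul_self_pos.2 ht) ((hσ0 j).lt_of_ne' hj)
          exact (((continuous_constraintMap j).mul hM).continuousAt.eventually
            (lt_mem_nhds hp)).mono fun x hx _ => hx
      filter_upwards [h1, h2] with x hx1 hx2 _ using ⟨hx1, hx2⟩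
    · simp only [activeCone, Set.mem_ofPred_eq, not_forall, not_le] at hmem
      obtain ⟨j, hj, hlt⟩ := hmem
      filter_upwards [(continuous_constraintMap j).continuousAt.eventually (gt_mem_nhds hlt)]
        with x hx hx'
      exact absurd (hx' j hj) (not_le.2 hx)
  filter_upwards [key] with V hV ν hν hν0
  have hn : 0 < ‖ν‖ := norm_pos_iff.2 hν0
  obtain ⟨h1, h2⟩ := hV (‖ν‖⁻¹ • ν) (by simp [norm_smul, hn.ne'])
    (smul_mem_activeCone hν (inv_nonneg.2 hn.le))
  refine ⟨fun h => h1 (by simp [h]), fun j hj => ?_⟩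
  have h3 := h2 j hj
  simp only [map_smul, Pi.smul_apply, smul_eq_mul] at h3
  rw [mul_mul_mul_comm] at h3
  exact pos_of_mul_pos_right h3 (by positivity)

/-- If all nonzero elements of the active cone have nonzero mass, the cone has elements of
every nonzero mass `ε`. -/
theorem exists_mem_activeCone_mass_eq {U V : Game m} {σ : Profile m → ℝ}
    (hσ : IsCorrelatedEquilibrium U σ)
    (huniq : ∀ μ, IsCorrelatedEquilibrium U μ → μ = σ)
    (hV : ∀ ν ∈ activeCone U σ V, ν ≠ 0 → totalMass m ν ≠ 0) {ε : ℝ} (hε : ε ≠ 0) :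
    ∃ ν ∈ activeCone U σ V, totalMass m ν = ε := by
  by_contra hno
  push Not at hno
  obtain ⟨α, c, hc, hpos, hzero, hs⟩ := exists_pos_annihilator_on_add
    (fun j => constraintMap U σ j = 0) (constraintMap V) (ε • totalMass m) (by
      intro x hx hg
      by_contra hx0
      have hmx := hV x hx hx0
      have hg' : 0 ≤ ε * totalMass m x := by simpa using hg
      refine hno ((ε / totalMass m x) • x) (smul_mem_activeCone hx ?_) ?_
      · rw [div_nonneg_iff]
        rcases mul_nonneg_iff.1 hg' with h | h
        · exact Or.inl h
        · exact Or.inr h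
      · simp [hmx])
  have hα : ∀ j, 0 ≤ α j := fun j => by
    by_cases h : constraintMap U σ j = 0
    · exact (hpos j h).le
    · exact (hzero j h).ge
  obtain ⟨R, hR, hcl, hsupp⟩ := exists_closed_product_subset_support hσ huniq
  obtain ⟨p, hp, hpR, -, hsum⟩ := exists_product_cancelling α hα R hR (by
    intro i a ha b hab
    refine hcl i a ha b ?_
    by_contra h
    exact hab.ne' (hzero (Sum.inl ⟨i, a, b⟩) h))
  -- Inside the product of the `R i` nonnegativity is inactive, so the weight is zero; outside, the
  -- distribution is zero.
  have h0 : ∑ s, α (Sum.inr s) * productDistribution p s = 0 := by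
    refine Finset.sum_eq_zero fun s _ => ?_
    by_cases h : ∀ i, s i ∈ R i
    · rw [hzero (Sum.inr s) (hsupp s h), zero_mul]
    · push Not at h
      obtain ⟨i, hi⟩ := h
      rw [productDistribution, Finset.prod_eq_zero (Finset.mem_univ i) (hpR i _ hi), mul_zero]
  have hm : totalMass m (productDistribution p) = 1 :=
    sum_productDistribution fun i => (hp i).2
  have := hs (productDistribution p)
  rw [hsum, h0, zero_add, LinearMap.smul_apply, hm, smul_eq_mul, mul_one] at this
  exact mul_ne_zero hc.ne' hε this

/-- A unique correlated equilibrium stays unique, with the same support, in nearby games. -/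
theorem eventually_unique_correlatedEquilibrium {U : Game m} {σ : Profile m → ℝ}
    (hσ : IsCorrelatedEquilibrium U σ)
    (huniq : ∀ μ, IsCorrelatedEquilibrium U μ → μ = σ) :
    ∀ᶠ V in 𝓝 U, ∃ τ : Profile m → ℝ, IsCorrelatedEquilibrium V τ ∧
      (∀ μ : Profile m → ℝ, IsCorrelatedEquilibrium V μ → μ = τ) ∧
      profileSupport τ = profileSupport σ := by
  filter_upwards [eventually_activeCone_strict hσ huniq] with V hV
  have hV0 : ∀ ν ∈ activeCone U σ V, ν ≠ 0 → totalMass m ν ≠ 0 := fun ν h h' => (hV ν h h').1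
  obtain ⟨τ, hτ, hτ1⟩ := exists_mem_activeCone_mass_eq hσ huniq hV0 one_ne_zero
  obtain ⟨ρ, hρ, hρ1⟩ := exists_mem_activeCone_mass_eq hσ huniq hV0
    (neg_ne_zero.2 (one_ne_zero (α := ℝ)))
  have hopp : ∀ μ ∈ activeCone U σ V, totalMass m μ = 1 → μ = -ρ := by
    intro μ hμ hμ1
    by_contra hne
    exact hV0 (μ + ρ) (add_mem_activeCone hμ hρ) (fun h => hne (eq_neg_of_add_eq_zero_left h))
      (by simp [hμ1, hρ1])
  have hτ0 : τ ≠ 0 := by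
    rintro rfl
    simp at hτ1
  have hstrict : ∀ j, constraintMap U σ j ≠ 0 → 0 < constraintMap V τ j := fun j hj => by
    simpa [hτ1] using (hV τ hτ hτ0).2 j hj
  refine ⟨τ, isCorrelatedEquilibrium_iff.2 ⟨hτ1, fun j => ?_⟩, fun μ hμ => ?_, ?_⟩
  · by_cases hj : constraintMap U σ j = 0
    · exact hτ j hj
    · exact (hstrict j hj).le
  · obtain ⟨h1, h0⟩ := isCorrelatedEquilibrium_iff.1 hμ
    rw [hopp μ (fun j _ => h0 j) h1, hopp τ hτ hτ1]
  · ext s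
    constructor
    · intro hs
      refine (hσ.1.1 s).lt_of_ne' fun h => ?_
      -- Active nonnegativity also binds `ρ = -τ`, so `τ` cannot be positive where `σ` vanishes.
      have hρs : 0 ≤ ρ s := hρ (Sum.inr s) h
      have hτs : 0 < τ s := hs
      rw [hopp τ hτ hτ1, Pi.neg_apply] at hτs
      linarith
    · intro hs
      exact hstrict (Sum.inr s) (ne_of_gt hs)

end Games

theorem proposition1 (n : ℕ) (m : Fin n → ℕ) :
    IsOpen {U : Game m | ∃! μ : Profile m → ℝ, IsCorrelatedEquilibrium U μ} ∧
    ∀ (U : Game m) (σ : Profile m → ℝ),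
      IsCorrelatedEquilibrium U σ →
      (∀ μ : Profile m → ℝ, IsCorrelatedEquilibrium U μ → μ = σ) →
      ∀ᶠ V in 𝓝 U, ∃ τ : Profile m → ℝ,
        IsCorrelatedEquilibrium V τ ∧
        (∀ μ : Profile m → ℝ, IsCorrelatedEquilibrium V μ → μ = τ) ∧
        profileSupport τ = profileSupport σ := by
  refine ⟨isOpen_iff_mem_nhds.2 ?_, fun U σ hσ huniq =>
    eventually_unique_correlatedEquilibrium hσ huniq⟩
  rintro U ⟨σ, hσ, huniq⟩
  filter_upwards [eventually_unique_correlatedEquilibrium hσ huniq] with V hV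
  obtain ⟨τ, hτ, hτu, -⟩ := hV
  exact ⟨τ, hτ, hτu⟩
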